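/- Let $n\ge 0$ and let $N$ be a convex $(n+3)$-gon. A triangulation of $N$ is identified with its set of diagonals (a maximal set of pairwise non-crossing diagonals of $N$). The *$n$-associahedron* $\mathcal{A}_n$ is the partially ordered set, under inclusion, consisting of the empty face (of rank $-1$) and all sets of the form $\{s : s \text{ a triangulation of } N,\ D\subseteq s\}$, where $D$ is a set of diagonals of some triangulation of $N$; such a face has rank $n-|D|$. A *colored triangulation* is a triangulation of $N$ whose diagonals are assigned colors from a fixed $n$-element set $R$ such that distinct diagonals have distinct colors. Two colored triangulations are joined by an edge of color $c\in R$ if one is obtained from the other by flipping the diagonal of color $c$ (replacing it by the other diagonal of the quadrilateral formed by the two triangles containing it), preserving its color and leaving all other colored diagonals unchanged. For $C\subseteq R$ and a colored triangulation $t$, let $(C,t)$ be the set of all colored triangulations that can be joined to $t$ by a path all of whose edges have colors in $C$. The *colorful $n$-associahedron* $\mathcal{A}^c_n$ is the set consisting of the empty face (of rank $-1$) and all the sets $(C,t)$ (of rank $|C|$), partially ordered by inclusion. The symmetric group $S_n$ on $R$ acts on $\mathcal{A}^c_n$ by automorphisms through permutation of the colors, $\sigma((C,t))=(\sigma(C),t_\sigma)$,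 where $t_\sigma$ is obtained from $t$ by replacing each color $c$ by $\sigma(c)$; the subgroup of the automorphism group of $\mathcal{A}^c_n$ arising in this way is again denoted by $S_n$. The quotient $\mathcal{A}^c_n/S_n$ is the set of $S_n$-orbits of faces, where an orbit $x$ is below an orbit $y$ if and only if there are faces $F\in x$ and $G\in y$ with $F\le G$. **Theorem.** For every $n\ge 0$, $$\mathcal{A}^c_n/S_n\;\cong\;\mathcal{A}_n .$$ Moreover, $\mathcal{A}^c_n$ covers $\mathcal{A}_n$: there is an isomorphism $\Phi:\mathcal{A}^c_n/S_n\to\mathcal{A}_n$ whose composition with the projection $\mathcal{A}^c_n\to\mathcal{A}^c_n/S_n$ is a covering, that is, a surjective order-preserving map which preserves the ranks of faces and maps any two adjacent flags of $\mathcal{A}^c_n$ (maximal chains differing in exactly one face) onto two adjacent flags of $\mathcal{A}_n$. -/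

import Mathlib

namespace Assoc

/-! ### Faces of the colorful polytope of an edge colored graph

An edge colored graph with vertex set `V` and color set `R` is given by the family `G : R → SimpleGraph V`
of its color classes: `(G c).Adj v w` says that `v` and `w` are joined by an edge of color `c`. -/

section Colorful

variable {V R : Type*}

/-- The face `(C, v)`: the equivalence class of `v` under `∼_C`, i.e. the set of all vertices which can be
joined to `v` by a path all of whose edges have colors in `C`. -/
def faceSet (G : R → SimpleGraph V) (C : Finset R) (v : V) : Set V :=
  {w | (⨆ c ∈ C, G c).Reachable v w}

/-- The colorful polytope of an edge colored graph. Its faces, identified with their vertex sets and ordered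
by inclusion, are the empty set and the sets `(C, v)`. -/
abbrev ColorfulPolytope (G : R → SimpleGraph V) : Type _ :=
  {F : Set V // F = ∅ ∨ ∃ (C : Finset R) (v : V), F = faceSet G C v}

/-- `F` is a `j`-face: the empty face has rank `-1`, and `(C, v)` has rank `|C|`. -/
def ColorfulPolytope.HasRank {G : R → SimpleGraph V} (F : ColorfulPolytope G) (j : ℤ) : Prop :=
  (F.1 = ∅ ∧ j = -1) ∨ ∃ (C : Finset R) (v : V), F.1 = faceSet G C v ∧ j = C.card

end Colorful

/-! ### Triangulations of a convex polygon and the associahedron -/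

/-- The diagonals of a convex `(n+3)`-gon with vertices `0, 1, …, n+2` in cyclic order: pairs `i < j` of
vertices which are not adjacent on the boundary. -/
abbrev Diagonal (n : ℕ) : Type :=
  {p : Fin (n + 3) × Fin (n + 3) //
    p.1.val + 1 < p.2.val ∧ ¬ (p.1.val = 0 ∧ p.2.val = n + 2)}

/-- Two diagonals of a convex polygon cross (meet in interior points) iff their end vertices interlace. -/
def Crosses {n : ℕ} (d e : Diagonal n) : Prop :=
  (d.1.1 < e.1.1 ∧ e.1.1 < d.1.2 ∧ d.1.2 < e.1.2) ∨
    (e.1.1 < d.1.1 ∧ d.1.1 < e.1.2 ∧ e.1.2 < d.1.2)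

/-- Triangulations of the convex `(n+3)`-gon, given by their sets of diagonals: a set of diagonals cuts
the polygon into triangles iff it is a maximal set of pairwise non-crossing diagonals. -/
abbrev Triangulation (n : ℕ) : Type :=
  {t : Finset (Diagonal n) // (∀ d ∈ t, ∀ e ∈ t, ¬ Crosses d e) ∧
    ∀ d, (∀ e ∈ t, ¬ Crosses d e) → d ∈ t}

/-- For `i < j`, the segment from `i` to `j` is an edge of a triangle of `t`: it is a side of the polygon
or a diagonal of `t`. -/
def Triangulation.HasEdge {n : ℕ} (t : Triangulation n) (i j : Fin (n + 3)) : Prop :=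
  i.val + 1 = j.val ∨ (i.val = 0 ∧ j.val = n + 2) ∨ ∃ d ∈ t.1, d.1 = (i, j)

/-- `t'` is obtained from `t` by flipping the diagonal `d` of `t`, which is replaced by `d'`: there is a
quadrilateral with vertices `a < b < c < e` whose four sides are edges of `t`, whose two diagonals are `d`
and `d'`, and `d` is replaced by `d'`. -/
def IsFlip {n : ℕ} (t t' : Triangulation n) (d d' : Diagonal n) : Prop :=
  d ∈ t.1 ∧
  (∃ a b c e : Fin (n + 3), a < b ∧ b < c ∧ c < e ∧
    t.HasEdge a b ∧ t.HasEdge b c ∧ t.HasEdge c e ∧ t.HasEdge a e ∧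
    ((d.1 = (a, c) ∧ d'.1 = (b, e)) ∨ (d.1 = (b, e) ∧ d'.1 = (a, c)))) ∧
  t'.1 = insert d' (t.1.erase d)

/-- The `n`-associahedron, as a face lattice. Faces are identified with their vertex sets and ordered by
inclusion; they are the empty face, and for every triangulation `t` and every set `D` of diagonals of `t`
the face whose vertices are all triangulations containing `D`. -/
abbrev Associahedron (n : ℕ) : Type :=
  {F : Set (Triangulation n) // F = ∅ ∨
    ∃ (t : Triangulation n) (D : Finset (Diagonal n)), D ⊆ t.1 ∧ F = {s | D ⊆ s.1}}

/-- `F` is a `j`-face: the empty face has rank `-1`, and the face of all triangulations having a given set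
`D` of `n - j` diagonals (of some triangulation) in common has rank `j`. -/
def Associahedron.HasRank {n : ℕ} (F : Associahedron n) (j : ℤ) : Prop :=
  (F.1 = ∅ ∧ j = -1) ∨
    ∃ (t : Triangulation n) (D : Finset (Diagonal n)),
      D ⊆ t.1 ∧ F.1 = {s | D ⊆ s.1} ∧ j = (n : ℤ) - D.card

/-! ### Colored triangulations and the colorful associahedron -/

/-- Colored triangulations: triangulations whose diagonals are assigned colors from the `n`-set `Fin n`
such that distinct diagonals have distinct colors. -/
structure ColoredTriangulation (n : ℕ) where
  /-- the underlying uncolored triangulation -/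
  supp : Triangulation n
  /-- the coloring of its diagonals -/
  color : {d // d ∈ supp.1} → Fin n
  color_injective : Function.Injective color

/-- `t'` is obtained from `t` by flipping the diagonal of color `k`, preserving its color and
leaving all other colored diagonals unchanged. -/
def IsColoredFlip {n : ℕ} (k : Fin n) (t t' : ColoredTriangulation n) : Prop :=
  ∃ (d d' : Diagonal n) (hd : d ∈ t.supp.1) (hd' : d' ∈ t'.supp.1),
    IsFlip t.supp t'.supp d d' ∧ t.color ⟨d, hd⟩ = k ∧ t'.color ⟨d', hd'⟩ = k ∧
    ∀ (e : Diagonal n) (he : e ∈ t.supp.1) (he' : e ∈ t'.supp.1),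
      t.color ⟨e, he⟩ = t'.color ⟨e, he'⟩

theorem HasEdge.of_flip {n : ℕ} {t t' : Triangulation n} {d d' : Diagonal n} {i j : Fin (n + 3)}
    (ht : t'.1 = insert d' (t.1.erase d)) (hij : d.1 ≠ (i, j)) (h : t.HasEdge i j) :
    t'.HasEdge i j := by
  rcases h with h | h | ⟨x, hx, hxe⟩
  · exact Or.inl h
  · exact Or.inr (Or.inl h)
  · refine Or.inr (Or.inr ⟨x, ?_, hxe⟩)
    rw [ht]
    refine Finset.mem_insert_of_mem (Finset.mem_erase.2 ⟨?_, hx⟩)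
    rintro rfl
    exact hij hxe

theorem IsFlip.symm {n : ℕ} {t t' : Triangulation n} {d d' : Diagonal n}
    (h : IsFlip t t' d d') : IsFlip t' t d' d := by
  obtain ⟨hd, ⟨a, b, c, e, hab, hbc, hce, h1, h2, h3, h4, h5⟩, ht⟩ := h
  have hac := hab.trans hbc
  have hbe := hbc.trans hce
  have hcr : Crosses d d' := by
    rcases h5 with ⟨hx, hy⟩ | ⟨hx, hy⟩
    · left; rw [hx, hy]; exact ⟨hab, hbc, hce⟩
    · right; rw [hx, hy]; exact ⟨hab, hbc, hce⟩
  have hd't : d' ∉ t.1 := fun hm => t.2.1 d hd d' hm hcr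
  have hne : ∀ i j : Fin (n + 3), (i, j) ≠ (a, c) → (i, j) ≠ (b, e) → d.1 ≠ (i, j) := by
    intro i j hi hj hd1
    rcases h5 with ⟨hx, -⟩ | ⟨hx, -⟩
    · exact hi (hd1.symm.trans hx)
    · exact hj (hd1.symm.trans hx)
  refine ⟨by rw [ht]; exact Finset.mem_insert_self _ _,
    ⟨a, b, c, e, hab, hbc, hce, ?_, ?_, ?_, ?_, ?_⟩, ?_⟩
  · refine HasEdge.of_flip ht (hne _ _ ?_ ?_) h1 <;> simp [hbc.ne, hab.ne]
  · refine HasEdge.of_flip ht (hne _ _ ?_ ?_) h2 <;> simp [hce.ne, hab.ne']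
  · refine HasEdge.of_flip ht (hne _ _ ?_ ?_) h3 <;> simp [hac.ne', hbc.ne']
  · refine HasEdge.of_flip ht (hne _ _ ?_ ?_) h4 <;> simp [hce.ne', hab.ne]
  · tauto
  · rw [ht, Finset.erase_insert (fun hm => hd't (Finset.mem_of_mem_erase hm)), Finset.insert_erase hd]

theorem IsFlip.ne {n : ℕ} {t t' : Triangulation n} {d d' : Diagonal n}
    (h : IsFlip t t' d d') : t ≠ t' := by
  have h' := h.symm
  obtain ⟨hd, ⟨a, b, c, e, hab, hbc, hce, -, -, -, -, h5⟩, ht⟩ := h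
  rintro rfl
  refine t.2.1 d hd d' h'.1 ?_
  rcases h5 with ⟨hx, hy⟩ | ⟨hx, hy⟩
  · left; rw [hx, hy]; exact ⟨hab, hbc, hce⟩
  · right; rw [hx, hy]; exact ⟨hab, hbc, hce⟩

theorem IsColoredFlip.symm {n : ℕ} {k : Fin n} {t t' : ColoredTriangulation n}
    (h : IsColoredFlip k t t') : IsColoredFlip k t' t := by
  obtain ⟨d, d', hd, hd', hf, h1, h2, h3⟩ := h
  exact ⟨d', d, hd', hd, hf.symm, h2, h1, fun e he he' => (h3 e he' he).symm⟩

/-- The colorful exchange graph: vertices are the colored triangulations, and edges of color `k` join two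
colored triangulations which differ by flipping the diagonal of color `k`. -/
def exchangeGraph (n : ℕ) (k : Fin n) : SimpleGraph (ColoredTriangulation n) where
  Adj := IsColoredFlip k
  symm := ⟨fun _ _ h => h.symm⟩
  loopless := ⟨fun _ ⟨_, _, _, _, hf, _⟩ => hf.ne rfl⟩

/-- The colorful `n`-associahedron: the colorful polytope of the colorful exchange graph. -/
abbrev ColorfulAssociahedron (n : ℕ) : Type :=
  ColorfulPolytope (exchangeGraph n)

/-! ### The color-permuting automorphisms -/

/-- `t_σ`: the colored triangulation obtained from `t` by replacing each color `c` by `σ c`. -/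
def recolor {n : ℕ} (σ : Equiv.Perm (Fin n)) (t : ColoredTriangulation n) :
    ColoredTriangulation n where
  supp := t.supp
  color := fun d => σ (t.color d)
  color_injective := σ.injective.comp t.color_injective

theorem recolor_mul {n : ℕ} (σ τ : Equiv.Perm (Fin n)) (t : ColoredTriangulation n) :
    recolor (σ * τ) t = recolor σ (recolor τ t) := rfl

theorem recolor_one {n : ℕ} (t : ColoredTriangulation n) : recolor 1 t = t := rfl

theorem IsColoredFlip.recolor {n : ℕ} (σ : Equiv.Perm (Fin n)) {k : Fin n}
    {t t' : ColoredTriangulation n} (h : IsColoredFlip k t t') :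
    IsColoredFlip (σ k) (recolor σ t) (recolor σ t') := by
  obtain ⟨d, d', hd, hd', hf, h1, h2, h3⟩ := h
  exact ⟨d, d', hd, hd', hf, congrArg σ h1, congrArg σ h2, fun e he he' => congrArg σ (h3 e he he')⟩

theorem reachable_recolor {n : ℕ} (σ : Equiv.Perm (Fin n)) (C : Finset (Fin n))
    {t s : ColoredTriangulation n} (h : (⨆ c ∈ C, exchangeGraph n c).Reachable t s) :
    (⨆ c ∈ C.map σ.toEmbedding, exchangeGraph n c).Reachable (recolor σ t) (recolor σ s) := by
  refine SimpleGraph.Reachable.map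
    (G := ⨆ c ∈ C, exchangeGraph n c)
    (G' := ⨆ c ∈ C.map σ.toEmbedding, exchangeGraph n c) ⟨recolor σ, ?_⟩ h
  intro a b hab
  simp only [SimpleGraph.iSup_adj] at hab ⊢
  obtain ⟨c, hc, hab⟩ := hab
  exact ⟨σ c, Finset.mem_map_of_mem _ hc, IsColoredFlip.recolor σ hab⟩

/-- `σ (C, t) = (σ(C), t_σ)`, as vertex sets. -/
theorem image_recolor_faceSet {n : ℕ} (σ : Equiv.Perm (Fin n)) (C : Finset (Fin n))
    (t : ColoredTriangulation n) :
    recolor σ '' faceSet (exchangeGraph n) C t =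
      faceSet (exchangeGraph n) (C.map σ.toEmbedding) (recolor σ t) := by
  ext s
  constructor
  · rintro ⟨r, hr, rfl⟩
    exact reachable_recolor σ C hr
  · intro hs
    refine ⟨recolor σ⁻¹ s, ?_, by rw [← recolor_mul, mul_inv_cancel, recolor_one]⟩
    have h := reachable_recolor σ⁻¹ _ hs
    have hC : (C.map σ.toEmbedding).map (σ⁻¹ : Equiv.Perm (Fin n)).toEmbedding = C := by
      ext x
      simp only [Finset.mem_map_equiv]
      exact Iff.of_eq (congrArg (· ∈ C) (σ.symm_apply_apply x))
    rw [hC, ← recolor_mul, inv_mul_cancel, recolor_one] at h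
    exact h

/-- The action of a color permutation on the faces of the colorful associahedron. -/
def recolorFace {n : ℕ} (σ : Equiv.Perm (Fin n)) (F : ColorfulAssociahedron n) :
    ColorfulAssociahedron n :=
  ⟨recolor σ '' F.1, by
    rcases F.2 with h | ⟨C, t, h⟩
    · left; rw [h, Set.image_empty]
    · right; exact ⟨C.map σ.toEmbedding, recolor σ t, by rw [h, image_recolor_faceSet]⟩⟩

theorem recolorFace_mul {n : ℕ} (σ τ : Equiv.Perm (Fin n)) (F : ColorfulAssociahedron n) :
    recolorFace (σ * τ) F = recolorFace σ (recolorFace τ F) :=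
  Subtype.ext (Set.image_comp (recolor σ) (recolor τ) F.1)

theorem recolorFace_one {n : ℕ} (F : ColorfulAssociahedron n) : recolorFace 1 F = F :=
  Subtype.ext (Set.image_id F.1)

theorem recolorFace_mono {n : ℕ} (σ : Equiv.Perm (Fin n)) {F G : ColorfulAssociahedron n}
    (h : F ≤ G) : recolorFace σ F ≤ recolorFace σ G :=
  Set.image_mono (f := recolor σ) (show F.1 ⊆ G.1 from h)

/-- The action of the symmetric group on the colors by automorphisms of the colorful associahedron. -/
def recolorHom (n : ℕ) :
    Equiv.Perm (Fin n) →* (ColorfulAssociahedron n ≃o ColorfulAssociahedron n) where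
  toFun σ :=
    { toFun := recolorFace σ
      invFun := recolorFace σ⁻¹
      left_inv := fun F => by rw [← recolorFace_mul, inv_mul_cancel, recolorFace_one]
      right_inv := fun F => by rw [← recolorFace_mul, mul_inv_cancel, recolorFace_one]
      map_rel_iff' := by
        intro F G
        refine ⟨fun h => ?_, recolorFace_mono σ⟩
        have h' := recolorFace_mono σ⁻¹ h
        simpa only [Equiv.coe_fn_mk, ← recolorFace_mul, inv_mul_cancel, recolorFace_one] using h' }
  map_one' := by
    apply RelIso.ext
    intro F
    exact recolorFace_one F
  map_mul' σ τ := by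
    apply RelIso.ext
    intro F
    exact recolorFace_mul σ τ F

/-- The color-permuting subgroup `S_n` of the automorphism group of the colorful associahedron. -/
def colorSubgroup (n : ℕ) : Subgroup (ColorfulAssociahedron n ≃o ColorfulAssociahedron n) :=
  (recolorHom n).range

/-! ### Quotients and coverings -/

section Quotients

variable {P Q : Type*} [PartialOrder P] [PartialOrder Q]

/-- The quotient of `P` by a group `H` of automorphisms: its faces are the orbits of faces of `P`. -/
def PolytopeQuotient (H : Subgroup (P ≃o P)) : Type _ :=
  MulAction.orbitRel.Quotient H P

/-- The orbit of a face. -/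
def PolytopeQuotient.mk (H : Subgroup (P ≃o P)) (F : P) : PolytopeQuotient H :=
  Quotient.mk (MulAction.orbitRel H P) F

/-- Incidence in the quotient: one orbit is below another iff they can be represented as the orbits of two
faces of `P`, the first of which is below the second. -/
instance PolytopeQuotient.instLE (H : Subgroup (P ≃o P)) : LE (PolytopeQuotient H) where
  le x y := ∃ F G : P, PolytopeQuotient.mk H F = x ∧ PolytopeQuotient.mk H G = y ∧ F ≤ G

/-- Two flags (maximal chains) are adjacent if they differ by exactly one face. -/
def AdjacentFlags (Φ Ψ : Flag P) : Prop :=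
  ((Φ : Set P) \ Ψ).ncard = 1 ∧ ((Ψ : Set P) \ Φ).ncard = 1

/-- A covering of ranked posets (`rkP F j` says that the face `F` has rank `j`): a surjective homomorphism
which preserves ranks and maps pairs of adjacent flags to pairs of adjacent flags. -/
structure IsCovering (rkP : P → ℤ → Prop) (rkQ : Q → ℤ → Prop) (π : P → Q) : Prop where
  monotone : Monotone π
  surjective : Function.Surjective π
  rank_preserving : ∀ F j, rkP F j ↔ rkQ (π F) j
  adjacency_preserving : ∀ Φ Ψ : Flag P, AdjacentFlags Φ Ψ →
    ∃ Φ' Ψ' : Flag Q, (Φ' : Set Q) = π '' Φ ∧ (Ψ' : Set Q) = π '' Ψ ∧ AdjacentFlags Φ' Ψ'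

end Quotients

end Assoc

namespace Assoc

/-! Forgetting colors sends colored triangulations to triangulations, and the covering is the
induced map `suppFace` on vertex sets. A path with colors in `C` never moves a diagonal colored
outside `C`, so the image of `(C, t)` lies in the face of all triangulations containing
`fixedDiagonals C t`. It is all of that face because triangulations sharing a set `D` of diagonals
are connected by flips outside `D` (`reflTransGen_flipStep`), and such flips lift to colored ones
(`image_supp_faceSet`).

A triangulation has exactly `n` diagonals (`card_eq`), so colorings are bijections. Hence any two
colorings of one triangulation differ by a permutation, which makes the fibers of `suppFace` the
color orbits; moreover `C` and the fixed diagonals determine each other, which gives ranks. Every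
diagonal can be flipped, so a face determines its set `D`, and inclusion of faces through a common
vertex is inclusion of color sets both upstairs and downstairs.

For flags, maximality passes to the image because intermediate faces lift. Adjacency survives
because two faces that replace one another cannot have the same image: a shared nonempty face, or a
shared edge in the case of vertices, would force them to be equal. -/

theorem exists_maximal_nat {P : ℕ → Prop} (b : ℕ) (hb : ∀ k, P k → k ≤ b) (h : ∃ k, P k) :
    ∃ k, P k ∧ ∀ l, P l → l ≤ k := by
  classical
  obtain ⟨k, hk⟩ := h
  exact ⟨Nat.findGreatest P b, Nat.findGreatest_spec (hb k hk) hk,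
    fun l hl => Nat.le_findGreatest (hb l hl) hl⟩

theorem exists_minimal_nat {P : ℕ → Prop} (h : ∃ k, P k) : ∃ k, P k ∧ ∀ l, P l → k ≤ l := by
  classical
  exact ⟨Nat.find h, Nat.find_spec h, fun l hl => Nat.find_min' h hl⟩

variable {n : ℕ}

/-! ### Edges, triangles and flips in a triangulation -/

theorem Diagonal.ext_val {d e : Diagonal n} (h1 : d.1.1.val = e.1.1.val)
    (h2 : d.1.2.val = e.1.2.val) : d = e :=
  Subtype.ext (Prod.ext (Fin.ext h1) (Fin.ext h2))

/-- The diagonal joining `i` and `j`. -/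
def Diagonal.ofNat (i j : ℕ) (h1 : i + 1 < j) (h2 : j ≤ n + 2) (h3 : ¬ (i = 0 ∧ j = n + 2)) :
    Diagonal n :=
  ⟨(⟨i, by omega⟩, ⟨j, by omega⟩), h1, h3⟩

theorem Crosses.symm {d e : Diagonal n} (h : Crosses d e) : Crosses e d := Or.symm h

theorem crosses_iff {d e : Diagonal n} : Crosses d e ↔
    (d.1.1.val < e.1.1.val ∧ e.1.1.val < d.1.2.val ∧ d.1.2.val < e.1.2.val) ∨
    (e.1.1.val < d.1.1.val ∧ d.1.1.val < e.1.2.val ∧ e.1.2.val < d.1.2.val) := Iff.rfl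

theorem IsFlip.not_mem {t t' : Triangulation n} {d d' : Diagonal n}
    (h : IsFlip t t' d d') : d ∉ t'.1 := by
  intro hd
  obtain rfl : d = d' := by
    rw [h.2.2] at hd
    simpa using hd
  exact h.ne (Subtype.ext (by rw [h.2.2, Finset.insert_erase h.1]))

/-- A segment that crosses one diagonal of a quadrilateral but none of its sides must be the other
diagonal. This arithmetic is what makes a flip unique. -/
theorem crosses_quad {a b c e x y : ℕ} (l1 : a < b) (l2 : b < c) (l3 : c < e)
    (s1 : ¬ (a < x ∧ x < b ∧ b < y)) (s2 : ¬ (b < x ∧ x < c ∧ c < y))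
    (s2' : ¬ (x < b ∧ b < y ∧ y < c)) (s3 : ¬ (x < c ∧ c < y ∧ y < e))
    (s4 : ¬ (a < x ∧ x < e ∧ e < y)) (s4' : ¬ (x < a ∧ a < y ∧ y < e)) :
    ((x < a ∧ a < y ∧ y < c) ∨ (a < x ∧ x < c ∧ c < y) → x = b ∧ y = e) ∧
      ((x < b ∧ b < y ∧ y < e) ∨ (b < x ∧ x < e ∧ e < y) → x = a ∧ y = c) := by
  constructor <;> rintro (h | h) <;> omega

namespace Triangulation

/-- `HasEdge` for end vertices given as natural numbers. -/
def Edge (t : Triangulation n) (i j : ℕ) : Prop :=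
  (i + 1 = j ∧ j ≤ n + 2) ∨ (i = 0 ∧ j = n + 2) ∨ ∃ d ∈ t.1, d.1.1.val = i ∧ d.1.2.val = j

variable {t : Triangulation n}

theorem Edge.hasEdge {a b : Fin (n + 3)} (h : t.Edge a.val b.val) : t.HasEdge a b := by
  rcases h with h | h | ⟨d, hd, h1, h2⟩
  · exact Or.inl h.1
  · exact Or.inr (Or.inl h)
  · exact Or.inr (Or.inr ⟨d, hd, Prod.ext (Fin.ext h1) (Fin.ext h2)⟩)

theorem edge_of_mem {d : Diagonal n} (hd : d ∈ t.1) : t.Edge d.1.1.val d.1.2.val :=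
  Or.inr (Or.inr ⟨d, hd, rfl, rfl⟩)

theorem Edge.lt {i j : ℕ} (h : t.Edge i j) : i < j := by
  rcases h with h | h | ⟨d, -, h1, h2⟩
  · omega
  · omega
  · have := d.2.1
    omega

theorem Edge.le {i j : ℕ} (h : t.Edge i j) : j ≤ n + 2 := by
  rcases h with h | h | ⟨d, -, h1, h2⟩
  · omega
  · omega
  · have := d.1.2.isLt
    omega

theorem Edge.exists_mem {i j : ℕ} (h : t.Edge i j) (h1 : i + 1 < j)
    (h2 : ¬ (i = 0 ∧ j = n + 2)) : ∃ d ∈ t.1, d.1.1.val = i ∧ d.1.2.val = j := by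
  rcases h with h | h | h
  · omega
  · exact absurd h h2
  · exact h

theorem edge_side {i : ℕ} (h : i < n + 2) : t.Edge i (i + 1) := Or.inl ⟨rfl, h⟩

theorem edge_long : t.Edge 0 (n + 2) := Or.inr (Or.inl ⟨rfl, rfl⟩)

theorem Edge.not_crosses {i j k l : ℕ} (h : t.Edge i j) (h' : t.Edge k l) (h1 : i < k)
    (h2 : k < j) (h3 : j < l) : False := by
  have hl := h'.le
  obtain ⟨d, hd, hd1, hd2⟩ := h.exists_mem (by omega) (by omega)
  obtain ⟨e, he, he1, he2⟩ := h'.exists_mem (by omega) (by omega)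
  refine t.2.1 d hd e he (crosses_iff.2 (Or.inl ?_))
  omega

theorem edge_of_forall_not_crosses {i j : ℕ} (h1 : i < j) (h2 : j ≤ n + 2)
    (h : ∀ k l, t.Edge k l → ¬ (i < k ∧ k < j ∧ j < l) ∧ ¬ (k < i ∧ i < l ∧ l < j)) :
    t.Edge i j := by
  by_cases h3 : i + 1 = j
  · exact Or.inl ⟨h3, h2⟩
  by_cases h4 : i = 0 ∧ j = n + 2
  · exact Or.inr (Or.inl h4)
  refine Or.inr (Or.inr ⟨Diagonal.ofNat i j (by omega) h2 h4, t.2.2 _ ?_, rfl, rfl⟩)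
  intro e he hc
  have := h _ _ (edge_of_mem he)
  rcases hc with hc | hc
  · exact this.1 hc
  · exact this.2 hc

/-- Every edge which does not join consecutive vertices is the longest side of a triangle. -/
theorem Edge.exists_apex {i j : ℕ} (h : t.Edge i j) (hij : i + 1 < j) :
    ∃ k, i < k ∧ k < j ∧ t.Edge i k ∧ t.Edge k j := by
  have hj := h.le
  -- The apex is the farthest neighbor of `i` before `j`: an edge crossing `(k, j)` would cross `(i,
  -- j)` or `(i, k)`, or start at `i` and contradict maximality.
  obtain ⟨k, ⟨hk, hkj⟩, hmax⟩ := exists_maximal_nat (P := fun k => t.Edge i k ∧ k < j) j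
    (fun k hk => hk.2.le) ⟨i + 1, edge_side (by omega), hij⟩
  have hik := hk.lt
  refine ⟨k, hik, hkj, hk, edge_of_forall_not_crosses hkj hj fun x y hxy => ⟨?_, ?_⟩⟩
  · rintro ⟨h1, h2, h3⟩
    exact h.not_crosses hxy (by omega) h2 h3
  · rintro ⟨h1, h2, h3⟩
    rcases lt_trichotomy x i with h4 | rfl | h4
    · exact hxy.not_crosses h h4 (by omega) h3
    · have := hmax y ⟨hxy, h3⟩
      omega
    · exact hk.not_crosses hxy h4 h1 h2

/-- A shortest edge `(a, c)` above `(p, q)`. -/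
theorem exists_min_edge (t : Triangulation n) {p q : ℕ} (hq : q ≤ n + 2)
    (hne : ¬ (p = 0 ∧ q = n + 2)) :
    ∃ a c, t.Edge a c ∧ a ≤ p ∧ q ≤ c ∧ (a < p ∨ q < c) ∧
      ∀ x y, t.Edge x y → x ≤ p → q ≤ y → (x < p ∨ q < y) → c - a ≤ y - x := by
  obtain ⟨k, ⟨a, c, h1, h2, h3, h4, h5⟩, hmin⟩ := exists_minimal_nat
    (P := fun k => ∃ a c, t.Edge a c ∧ a ≤ p ∧ q ≤ c ∧ (a < p ∨ q < c) ∧ c - a = k)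
    ⟨_, 0, n + 2, edge_long, by omega, hq, by omega, rfl⟩
  exact ⟨a, c, h1, h2, h3, h4, fun x y e1 e2 e3 e4 =>
    h5 ▸ hmin _ ⟨x, y, e1, e2, e3, e4, rfl⟩⟩

/-- This is the triangle on the outer side of an edge. The apex below a shortest edge strictly above
`(i, j)` cannot lie strictly between `i` and `j` without a crossing, and minimality then makes `(i,
j)` a side of that triangle. -/
theorem Edge.exists_apex_above {i j : ℕ} (h : t.Edge i j) (hne : ¬ (i = 0 ∧ j = n + 2)) :
    (∃ a, a < i ∧ t.Edge a i ∧ t.Edge a j) ∨ ∃ c, j < c ∧ t.Edge i c ∧ t.Edge j c := by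
  obtain ⟨a, c, hac, ha, hc, hlt, hmin⟩ := t.exists_min_edge h.le hne
  have hij := h.lt
  obtain ⟨k, h1, h2, hak, hkc⟩ := hac.exists_apex (by omega)
  rcases le_or_gt k i with hk | hk
  · have := hmin k c hkc hk hc
    obtain rfl : k = i := by omega
    obtain rfl : c = j := by omega
    exact Or.inl ⟨a, h1, hak, hac⟩
  rcases le_or_gt j k with hk' | hk'
  · have := hmin a k hak ha hk'
    obtain rfl : k = j := by omega
    obtain rfl : a = i := by omega
    exact Or.inr ⟨c, h2, hac, hkc⟩
  · exfalso
    rcases ha.lt_or_eq with ha | rfl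
    · exact hak.not_crosses h ha hk hk'
    · exact h.not_crosses hkc hk hk' (by omega)

/-- A diagonal of a quadrilateral with sides in `t` can be replaced by the other one. -/
theorem exists_isFlip_of_quad {a b c e : ℕ} (hab : t.Edge a b) (hbc : t.Edge b c)
    (hce : t.Edge c e) (hae : t.Edge a e) {d d' : Diagonal n} (hd : d ∈ t.1)
    (h : (d.1.1.val = a ∧ d.1.2.val = c ∧ d'.1.1.val = b ∧ d'.1.2.val = e) ∨
      (d.1.1.val = b ∧ d.1.2.val = e ∧ d'.1.1.val = a ∧ d'.1.2.val = c)) :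
    ∃ t', IsFlip t t' d d' := by
  have l1 := hab.lt
  have l2 := hbc.lt
  have l3 := hce.lt
  have l4 := hae.le
  have hdd : Crosses d d' := by rw [crosses_iff]; omega
  -- Once `d` is removed, `d` and `d'` are the only compatible diagonals that can obstruct each
  -- other; both non-crossing and maximality of the new set follow.
  have key : ∀ x : Diagonal n, (∀ y ∈ t.1.erase d, ¬ Crosses x y) →
      (Crosses x d → x = d') ∧ (Crosses x d' → x = d) := by
    intro x hx
    have side : ∀ i j, t.Edge i j → ¬ (i = d.1.1.val ∧ j = d.1.2.val) →
        ¬ (x.1.1.val < i ∧ i < x.1.2.val ∧ x.1.2.val < j) ∧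
        ¬ (i < x.1.1.val ∧ x.1.1.val < j ∧ j < x.1.2.val) := by
      intro i j hij hne
      have x1 := x.2.1
      have x2 := x.1.2.isLt
      have hle := hij.le
      by_cases hs : i + 1 < j ∧ ¬ (i = 0 ∧ j = n + 2)
      · obtain ⟨y, hy, rfl, rfl⟩ := hij.exists_mem hs.1 hs.2
        have := hx y (Finset.mem_erase.2 ⟨by rintro rfl; exact hne ⟨rfl, rfl⟩, hy⟩)
        rw [crosses_iff] at this
        tauto
      · omega
    have s1 := side a b hab (by omega)
    have s2 := side b c hbc (by omega)
    have s3 := side c e hce (by omega)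
    have s4 := side a e hae (by omega)
    obtain ⟨q1, q2⟩ := crosses_quad l1 l2 l3 s1.2 s2.2 s2.1 s3.1 s4.2 s4.1
    simp only [crosses_iff]
    rcases h with ⟨h1, h2, h3, h4⟩ | ⟨h1, h2, h3, h4⟩ <;> rw [h1, h2, h3, h4]
    · exact ⟨fun hc => Diagonal.ext_val ((q1 hc).1.trans h3.symm) ((q1 hc).2.trans h4.symm),
        fun hc => Diagonal.ext_val ((q2 hc).1.trans h1.symm) ((q2 hc).2.trans h2.symm)⟩
    · exact ⟨fun hc => Diagonal.ext_val ((q2 hc).1.trans h3.symm) ((q2 hc).2.trans h4.symm),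
        fun hc => Diagonal.ext_val ((q1 hc).1.trans h1.symm) ((q1 hc).2.trans h2.symm)⟩
  have hd' : d' ∉ t.1 := fun hm => t.2.1 d hd d' hm hdd
  have hne : d ≠ d' := fun h => hd' (h ▸ hd)
  have hnew : ∀ x ∈ t.1.erase d, ¬ Crosses x d' := fun x hx hc =>
    Finset.ne_of_mem_erase hx ((key x fun y hy => t.2.1 x (Finset.mem_of_mem_erase hx) y
      (Finset.mem_of_mem_erase hy)).2 hc)
  refine ⟨⟨insert d' (t.1.erase d), ?_, ?_⟩, hd, ?_, rfl⟩
  · intro x hx y hy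
    rcases Finset.mem_insert.1 hx with rfl | hx' <;> rcases Finset.mem_insert.1 hy with rfl | hy'
    · rw [crosses_iff]; omega
    · exact fun hc => hnew y hy' hc.symm
    · exact hnew x hx'
    · exact t.2.1 x (Finset.mem_of_mem_erase hx') y (Finset.mem_of_mem_erase hy')
  · intro x hx
    have hx' : ∀ y ∈ t.1.erase d, ¬ Crosses x y := fun y hy => hx y (Finset.mem_insert_of_mem hy)
    by_cases hc : Crosses x d
    · rw [(key x hx').1 hc]
      exact Finset.mem_insert_self _ _
    · refine Finset.mem_insert_of_mem (Finset.mem_erase.2 ⟨?_, t.2.2 x fun y hy => ?_⟩)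
      · rintro rfl
        exact hx d' (Finset.mem_insert_self _ _) hdd
      · by_cases hyd : y = d
        · rwa [hyd]
        · exact hx' y (Finset.mem_erase.2 ⟨hyd, hy⟩)
  · refine ⟨⟨a, by omega⟩, ⟨b, by omega⟩, ⟨c, by omega⟩, ⟨e, by omega⟩, l1, l2, l3,
      Edge.hasEdge hab, Edge.hasEdge hbc, Edge.hasEdge hce, Edge.hasEdge hae, ?_⟩
    rcases h with ⟨h1, h2, h3, h4⟩ | ⟨h1, h2, h3, h4⟩
    · exact Or.inl ⟨Prod.ext (Fin.ext h1) (Fin.ext h2), Prod.ext (Fin.ext h3) (Fin.ext h4)⟩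
    · exact Or.inr ⟨Prod.ext (Fin.ext h1) (Fin.ext h2), Prod.ext (Fin.ext h3) (Fin.ext h4)⟩

/-- The triangles on the two sides of `d` form the quadrilateral in which `d` is flipped. -/
theorem exists_isFlip (t : Triangulation n) {d : Diagonal n} (hd : d ∈ t.1) :
    ∃ t' d', IsFlip t t' d d' := by
  have h := edge_of_mem hd
  have hle := h.le
  obtain ⟨k, h1, h2, hik, hkj⟩ := h.exists_apex d.2.1
  rcases h.exists_apex_above d.2.2 with ⟨a, ha, hai, haj⟩ | ⟨c, hc, hic, hjc⟩
  · obtain ⟨t', ht'⟩ := exists_isFlip_of_quad (d' := Diagonal.ofNat a k (by omega) (by omega)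
      (by omega)) hai hik hkj haj hd (Or.inr ⟨rfl, rfl, rfl, rfl⟩)
    exact ⟨t', _, ht'⟩
  · have := hjc.le
    obtain ⟨t', ht'⟩ := exists_isFlip_of_quad (d' := Diagonal.ofNat k c (by omega) (by omega)
      (by omega)) hik hkj hjc hic hd (Or.inl ⟨rfl, rfl, rfl, rfl⟩)
    exact ⟨t', _, ht'⟩

/-! ### The number of diagonals -/

theorem Edge.apex_unique {i j i' j' k : ℕ} (h : t.Edge i j) (hik : t.Edge i k) (hkj : t.Edge k j)
    (h' : t.Edge i' j') (hik' : t.Edge i' k) (hkj' : t.Edge k j') : i = i' ∧ j = j' := by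
  have l1 := hik.lt
  have l2 := hkj.lt
  have l3 := hik'.lt
  have l4 := hkj'.lt
  constructor
  · rcases lt_trichotomy i i' with hi | hi | hi
    · exact (hik.not_crosses h' hi l3 l4).elim
    · exact hi
    · exact (hik'.not_crosses h hi l1 l2).elim
  · rcases lt_trichotomy j j' with hj | hj | hj
    · exact (h.not_crosses hkj' l1 l2 hj).elim
    · exact hj
    · exact (h'.not_crosses hkj l3 l4 hj).elim

/-- The smallest and the largest neighbor of `k` are joined by an edge, since a crossing edge would
have to cross an edge at `k` or yield a more extreme neighbor. -/
theorem exists_edge_of_apex (t : Triangulation n) {k : ℕ} (h0 : 0 < k) (hk : k < n + 2) :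
    ∃ i j, t.Edge i j ∧ t.Edge i k ∧ t.Edge k j := by
  obtain ⟨i, hi, hmin⟩ := exists_minimal_nat (P := fun i => t.Edge i k)
    ⟨k - 1, Or.inl (by omega)⟩
  obtain ⟨j, hj, hmax⟩ := exists_maximal_nat (P := fun j => t.Edge k j) (n + 2)
    (fun j hj => hj.le) ⟨k + 1, edge_side hk⟩
  have l1 := hi.lt
  have l2 := hj.lt
  refine ⟨i, j, edge_of_forall_not_crosses (by omega) hj.le fun x y hxy => ⟨?_, ?_⟩, hi, hj⟩
  · rintro ⟨h1, h2, h3⟩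
    rcases lt_trichotomy x k with hx | rfl | hx
    · exact hi.not_crosses hxy h1 hx (by omega)
    · have := hmax y hxy
      omega
    · exact hj.not_crosses hxy hx h2 h3
  · rintro ⟨h1, h2, h3⟩
    rcases lt_trichotomy y k with hy | rfl | hy
    · exact hxy.not_crosses hi h1 h2 hy
    · have := hmin x hxy
      omega
    · exact hxy.not_crosses hj (by omega) hy h3

/-- Sending an edge to the apex of the triangle below it is a bijection from the diagonals together
with the long side `(0, n + 2)` to the `n + 1` vertices strictly between `0` and `n + 2`. -/
theorem card_eq (t : Triangulation n) : t.1.card = n := by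
  classical
  let f : Diagonal n → ℕ × ℕ := fun d => (d.1.1.val, d.1.2.val)
  have hf : Function.Injective f := fun d e h =>
    Diagonal.ext_val (congrArg Prod.fst h) (congrArg Prod.snd h)
  have hmem : ∀ p, p ∈ insert (0, n + 2) (t.1.image f) ↔ t.Edge p.1 p.2 ∧ p.1 + 1 < p.2 := by
    rintro ⟨i, j⟩
    simp only [Finset.mem_insert, Finset.mem_image, Prod.mk.injEq, f]
    constructor
    · rintro (⟨rfl, rfl⟩ | ⟨d, hd, rfl, rfl⟩)
      · exact ⟨edge_long, by omega⟩
      · exact ⟨edge_of_mem hd, d.2.1⟩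
    · rintro ⟨h | h | h, hij⟩
      · exact absurd h.1 hij.ne
      · exact Or.inl h
      · exact Or.inr h
  have hc : (insert (0, n + 2) (t.1.image f)).card = t.1.card + 1 := by
    rw [Finset.card_insert_of_notMem, Finset.card_image_of_injective _ hf]
    simp only [Finset.mem_image, not_exists, not_and, f, Prod.mk.injEq]
    exact fun d _ => not_and.1 d.2.2
  have hex : ∀ p ∈ insert (0, n + 2) (t.1.image f),
      ∃ k, p.1 < k ∧ k < p.2 ∧ t.Edge p.1 k ∧ t.Edge k p.2 := fun p hp =>
    ((hmem p).1 hp).1.exists_apex ((hmem p).1 hp).2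
  choose g hg1 hg2 hg3 hg4 using hex
  have hb : (insert (0, n + 2) (t.1.image f)).card = (Finset.Ioo 0 (n + 2)).card := by
    refine Finset.card_bij g ?_ ?_ ?_
    · intro p hp
      have := ((hmem p).1 hp).1.le
      have := hg1 p hp
      have := hg2 p hp
      rw [Finset.mem_Ioo]
      omega
    · intro p hp q hq h
      have := ((hmem p).1 hp).1.apex_unique (hg3 p hp) (hg4 p hp) ((hmem q).1 hq).1
        (h ▸ hg3 q hq) (h ▸ hg4 q hq)
      exact Prod.ext this.1 this.2
    · intro k hk
      rw [Finset.mem_Ioo] at hk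
      obtain ⟨i, j, hij, hik, hkj⟩ := t.exists_edge_of_apex hk.1 hk.2
      have l1 := hik.lt
      have l2 := hkj.lt
      have hp := (hmem (i, j)).2 ⟨hij, by simp only; omega⟩
      refine ⟨(i, j), hp, ?_⟩
      have a1 := hg3 _ hp
      have a2 := hg4 _ hp
      have m1 := hg1 _ hp
      have m2 := hg2 _ hp
      simp only at a1 a2 m1 m2
      rcases lt_trichotomy (g (i, j) hp) k with h | h | h
      · exact (hik.not_crosses a2 m1 h l2).elim
      · exact h
      · exact (a1.not_crosses hkj l1 h m2).elim
  rw [hc, Nat.card_Ioo] at hb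
  omega

/-! ### Connectedness of the faces under flips -/

/-- `t'` arises from `t` by flipping a diagonal outside of `D`. -/
def FlipStep (D : Finset (Diagonal n)) (t t' : Triangulation n) : Prop :=
  ∃ d d', d ∉ D ∧ IsFlip t t' d d'

theorem FlipStep.mono {D D' : Finset (Diagonal n)} (h : D ⊆ D') {t t' : Triangulation n}
    (hs : FlipStep D' t t') : FlipStep D t t' := by
  obtain ⟨d, d', hd, hf⟩ := hs
  exact ⟨d, d', fun hm => hd (h hm), hf⟩

theorem FlipStep.subset {D : Finset (Diagonal n)} {t t' : Triangulation n}
    (hs : FlipStep D t t') (h : D ⊆ t.1) : D ⊆ t'.1 := by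
  obtain ⟨d, d', hd, hf⟩ := hs
  intro x hx
  rw [hf.2.2]
  exact Finset.mem_insert_of_mem (Finset.mem_erase.2 ⟨fun hxd => hd (hxd ▸ hx), h hx⟩)

theorem subset_of_reflTransGen {D : Finset (Diagonal n)} {t t' : Triangulation n}
    (hs : Relation.ReflTransGen (FlipStep D) t t') (h : D ⊆ t.1) : D ⊆ t'.1 := by
  induction hs with
  | refl => exact h
  | tail _ hs ih => exact hs.subset ih

/-- If `x` crosses `d`, the distance from the smaller end of `d` to the end of `x` beyond `d`. -/
def crossWeight (d x : Diagonal n) : ℕ :=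
  if x.1.1.val < d.1.1.val ∧ d.1.1.val < x.1.2.val ∧ x.1.2.val < d.1.2.val then
    x.1.2.val - d.1.1.val
  else if d.1.1.val < x.1.1.val ∧ x.1.1.val < d.1.2.val ∧ d.1.2.val < x.1.2.val then
    x.1.1.val - d.1.1.val
  else 0

/-- Below the shortest edge `(a, c)` strictly above `d` there is a triangle whose apex `k` lies
strictly between the ends of `d`, so one of its sides crosses `d`; flip that side. The new diagonal
may still cross `d`, so the number of crossings need not drop, but the weight does. -/
theorem exists_isFlip_crossWeight_lt (t : Triangulation n) {d : Diagonal n} (hd : d ∉ t.1) :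
    ∃ t' x x', IsFlip t t' x x' ∧ Crosses x d ∧ crossWeight d x' < crossWeight d x := by
  have hd1 := d.2.1
  have hd2 := d.1.2.isLt
  obtain ⟨a, c, hac, ha, hc, hlt, hmin⟩ := t.exists_min_edge (by omega) d.2.2
  have hcn := hac.le
  obtain ⟨k, h1, h2, hak, hkc⟩ := hac.exists_apex (by omega)
  have hnd : ∀ i j, t.Edge i j → ¬ (i = d.1.1.val ∧ j = d.1.2.val) := by
    rintro i j hij ⟨rfl, rfl⟩
    obtain ⟨x, hx, hx1, hx2⟩ := hij.exists_mem d.2.1 d.2.2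
    exact hd (Diagonal.ext_val hx1 hx2 ▸ hx)
  have hk1 : d.1.1.val < k := by
    by_contra hk
    have := hmin k c hkc (by omega) hc
    have := hnd k c hkc
    omega
  have hk2 : k < d.1.2.val := by
    by_contra hk
    have := hmin a k hak ha (by omega)
    have := hnd a k hak
    omega
  rcases ha.lt_or_eq with ha | ha
  · obtain ⟨m, h3, h4, ham, hmk⟩ := hak.exists_apex (by omega)
    obtain ⟨x, hx, hx1, hx2⟩ := hak.exists_mem (by omega) (by omega)
    let x' : Diagonal n := Diagonal.ofNat m c (by omega) (by omega) (by omega)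
    have hx1' : x'.1.1.val = m := rfl
    have hx2' : x'.1.2.val = c := rfl
    obtain ⟨t', ht'⟩ := exists_isFlip_of_quad (d' := x') ham hmk hkc hac hx
      (Or.inl ⟨hx1, hx2, rfl, rfl⟩)
    refine ⟨t', x, x', ht', ?_, ?_⟩
    · rw [crosses_iff]; omega
    · unfold crossWeight
      split_ifs <;> omega
  · obtain ⟨m, h3, h4, hkm, hmc⟩ := hkc.exists_apex (by omega)
    obtain ⟨x, hx, hx1, hx2⟩ := hkc.exists_mem (by omega) (by omega)
    let x' : Diagonal n := Diagonal.ofNat a m (by omega) (by omega) (by omega)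
    have hx1' : x'.1.1.val = a := rfl
    have hx2' : x'.1.2.val = m := rfl
    obtain ⟨t', ht'⟩ := exists_isFlip_of_quad (d' := x') hak hkm hmc hac hx
      (Or.inr ⟨hx1, hx2, rfl, rfl⟩)
    refine ⟨t', x, x', ht', ?_, ?_⟩
    · rw [crosses_iff]; omega
    · unfold crossWeight
      split_ifs <;> omega

/-- Each flip removes a diagonal crossing `d`, hence one outside `D`, and the total weight
decreases. -/
theorem exists_reflTransGen_mem (t : Triangulation n) {d : Diagonal n} {D : Finset (Diagonal n)}
    (hD : ∀ x ∈ D, ¬ Crosses x d) :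
    ∃ t', Relation.ReflTransGen (FlipStep D) t t' ∧ d ∈ t'.1 := by
  induction hN : ∑ x ∈ t.1, crossWeight d x using Nat.strong_induction_on generalizing t with
  | _ N ih =>
    by_cases hd : d ∈ t.1
    · exact ⟨t, .refl, hd⟩
    obtain ⟨t₁, x, x', hf, hx, hlt⟩ := t.exists_isFlip_crossWeight_lt hd
    have hsum : ∑ y ∈ t₁.1, crossWeight d y < N := by
      rw [← hN, ← Finset.add_sum_erase _ _ hf.1, hf.2.2]
      by_cases hm : x' ∈ t.1.erase x
      · rw [Finset.insert_eq_of_mem hm]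
        omega
      · rw [Finset.sum_insert hm]
        omega
    obtain ⟨t', h1, h2⟩ := ih _ hsum t₁ rfl
    exact ⟨t', .head ⟨x, x', fun hm => hD x hm hx, hf⟩ h1, h2⟩

theorem eq_of_subset {s t : Triangulation n} (h : s.1 ⊆ t.1) : s = t :=
  Subtype.ext (h.antisymm fun d hd => s.2.2 d fun e he => t.2.1 d hd e (h he))

/-- Any two triangulations containing `D` are joined by flips of diagonals outside of `D`. -/
theorem reflTransGen_flipStep {D : Finset (Diagonal n)} {t s : Triangulation n} (ht : D ⊆ t.1)
    (hs : D ⊆ s.1) : Relation.ReflTransGen (FlipStep D) t s := by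
  classical
  induction hN : (s.1 \ t.1).card using Nat.strong_induction_on generalizing t with
  | _ N ih =>
    by_cases hst : s.1 ⊆ t.1
    · rw [eq_of_subset hst]
    obtain ⟨d, hds, hdt⟩ := Finset.not_subset.1 hst
    -- All diagonals already shared with `s` are kept while `d` is added, so fewer diagonals of `s`
    -- are missing.
    obtain ⟨t₁, h1, h2⟩ := t.exists_reflTransGen_mem (d := d) (D := s.1 ∩ t.1)
      fun x hx => s.2.1 x (Finset.mem_inter.1 hx).1 d hds
    have hsub := subset_of_reflTransGen h1 Finset.inter_subset_right
    refine Relation.ReflTransGen.trans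
      (Relation.ReflTransGen.mono (fun _ _ => FlipStep.mono (Finset.subset_inter hs ht)) _ _ h1)
      (ih _ ?_ ((Finset.subset_inter hs ht).trans hsub) rfl)
    rw [← hN]
    refine Finset.card_lt_card ⟨fun x hx => ?_, fun hsub' => ?_⟩
    · rw [Finset.mem_sdiff] at hx ⊢
      exact ⟨hx.1, fun hxt => hx.2 (hsub (Finset.mem_inter.2 ⟨hx.1, hxt⟩))⟩
    · exact (Finset.mem_sdiff.1 (hsub' (Finset.mem_sdiff.2 ⟨hds, hdt⟩))).2 h2

end Triangulation

/-! ### Colorings and fixed diagonals -/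

namespace ColoredTriangulation

theorem ext_color {t s : ColoredTriangulation n} (h : t.supp = s.supp)
    (hc : ∀ d (hd : d ∈ t.supp.1) (hd' : d ∈ s.supp.1), t.color ⟨d, hd⟩ = s.color ⟨d, hd'⟩) :
    t = s := by
  obtain ⟨u, f, hf⟩ := t
  obtain ⟨u', g, hg⟩ := s
  obtain rfl : u = u' := h
  obtain rfl : f = g := funext fun d => hc d.1 d.2 d.2
  rfl

theorem color_bijective (t : ColoredTriangulation n) : Function.Bijective t.color :=
  (Fintype.bijective_iff_injective_and_card _).2
    ⟨t.color_injective, by rw [Fintype.card_coe, t.supp.card_eq, Fintype.card_fin]⟩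

instance : Finite (ColoredTriangulation n) := by
  refine Finite.of_injective
    (fun t : ColoredTriangulation n =>
      (⟨t.supp, t.color⟩ : Σ u : Triangulation n, {d // d ∈ u.1} → Fin n)) ?_
  rintro ⟨u, f, hf⟩ ⟨u', g, hg⟩ h
  simp only [Sigma.mk.injEq] at h
  obtain ⟨rfl, h⟩ := h
  obtain rfl := eq_of_heq h
  rfl

theorem exists_supp_eq (u : Triangulation n) : ∃ t : ColoredTriangulation n, t.supp = u := by
  have e : {d // d ∈ u.1} ≃ Fin n :=
    Fintype.equivFinOfCardEq (by rw [Fintype.card_coe, u.card_eq])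
  exact ⟨⟨u, e, e.injective⟩, rfl⟩

/-- Both colorings are bijections onto the colors, so one composed with the inverse of the other is
the required permutation. -/
theorem exists_recolor_eq {t s : ColoredTriangulation n} (h : t.supp = s.supp) :
    ∃ σ, recolor σ t = s := by
  have ht := t.color_bijective
  have hs := s.color_bijective
  obtain ⟨u, f, hf⟩ := t
  obtain ⟨u', g, hg⟩ := s
  obtain rfl : u = u' := h
  refine ⟨(Equiv.ofBijective f ht).symm.trans (Equiv.ofBijective g hs), ext_color rfl ?_⟩
  intro d hd _
  exact congrArg g ((Equiv.ofBijective f ht).symm_apply_apply ⟨d, hd⟩)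

/-- A flip of the underlying triangulation lifts to a flip of colored triangulations. -/
theorem exists_isColoredFlip (t : ColoredTriangulation n) {u : Triangulation n} {d d' : Diagonal n}
    (h : IsFlip t.supp u d d') :
    ∃ s : ColoredTriangulation n, s.supp = u ∧ IsColoredFlip (t.color ⟨d, h.1⟩) t s := by
  have hd := h.not_mem
  have hd' := h.symm.not_mem
  have hu : ∀ e ∈ u.1, e ∉ t.supp.1 → e = d' := by
    intro e he het
    rw [h.2.2] at he
    exact (Finset.mem_insert.1 he).resolve_right fun hm => het (Finset.mem_of_mem_erase hm)
  -- Surviving diagonals keep their colors; the only new one inherits the color of `d`.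
  let f : {e // e ∈ u.1} → Fin n := fun e =>
    if he : e.1 ∈ t.supp.1 then t.color ⟨e.1, he⟩ else t.color ⟨d, h.1⟩
  have hf : Function.Injective f := by
    rintro ⟨x, hx⟩ ⟨y, hy⟩ hxy
    simp only [f] at hxy
    split_ifs at hxy with h1 h2 h2
    · have : x = y := congrArg Subtype.val (t.color_injective hxy)
      exact Subtype.ext this
    · have : x = d := congrArg Subtype.val (t.color_injective hxy)
      exact absurd (this ▸ hx) hd
    · have : d = y := congrArg Subtype.val (t.color_injective hxy)
      exact absurd (this ▸ hy) hd
    · exact Subtype.ext ((hu x hx h1).trans (hu y hy h2).symm)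
  refine ⟨⟨u, f, hf⟩, rfl, d, d', h.1, h.symm.1, h, rfl, dif_neg hd', fun e he _ => ?_⟩
  simp only [f, dif_pos he]

/-- The diagonals of `t` with colors outside of `C`. -/
def fixedDiagonals (C : Finset (Fin n)) (t : ColoredTriangulation n) : Finset (Diagonal n) :=
  (t.supp.1.attach.filter fun d => t.color d ∉ C).map (Function.Embedding.subtype _)

variable {C C' : Finset (Fin n)} {t s : ColoredTriangulation n}

theorem mem_fixedDiagonals {d : Diagonal n} :
    d ∈ fixedDiagonals C t ↔ ∃ h : d ∈ t.supp.1, t.color ⟨d, h⟩ ∉ C := by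
  simp [fixedDiagonals]

theorem fixedDiagonals_subset (C : Finset (Fin n)) (t : ColoredTriangulation n) :
    fixedDiagonals C t ⊆ t.supp.1 := fun _ hd => (mem_fixedDiagonals.1 hd).1

theorem fixedDiagonals_subset_iff : fixedDiagonals C t ⊆ fixedDiagonals C' t ↔ C' ⊆ C := by
  constructor
  · intro h c hc
    obtain ⟨⟨d, hd⟩, rfl⟩ := t.color_bijective.2 c
    by_contra hC
    exact (mem_fixedDiagonals.1 (h (mem_fixedDiagonals.2 ⟨hd, hC⟩))).2 hc
  · intro h d hd
    obtain ⟨h1, h2⟩ := mem_fixedDiagonals.1 hd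
    exact mem_fixedDiagonals.2 ⟨h1, fun h3 => h2 (h h3)⟩

theorem card_fixedDiagonals (C : Finset (Fin n)) (t : ColoredTriangulation n) :
    ((fixedDiagonals C t).card : ℤ) = n - C.card := by
  have h : (t.supp.1.attach.filter fun d => t.color d ∉ C).card = Cᶜ.card := by
    rw [← Finset.card_image_of_injective _ t.color_injective]
    congr 1
    ext c
    obtain ⟨d, rfl⟩ := t.color_bijective.2 c
    simp only [Finset.mem_image, Finset.mem_filter, Finset.mem_attach, true_and, Finset.mem_compl]
    exact ⟨fun ⟨e, he, hed⟩ => hed ▸ he, fun hd => ⟨d, hd, rfl⟩⟩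
  have hC : C.card ≤ n := by simpa using Finset.card_le_univ C
  rw [fixedDiagonals, Finset.card_map, h, Finset.card_compl, Fintype.card_fin, Nat.cast_sub hC]

theorem exists_fixedDiagonals_eq {D : Finset (Diagonal n)} (h : D ⊆ t.supp.1) :
    ∃ C, fixedDiagonals C t = D := by
  classical
  -- The colors not used on `D`.
  refine ⟨Finset.univ.filter fun c => ∀ d : {d // d ∈ t.supp.1}, t.color d = c → d.1 ∉ D, ?_⟩
  ext d
  simp only [mem_fixedDiagonals, Finset.mem_filter, Finset.mem_univ, true_and]
  constructor
  · rintro ⟨hd, h1⟩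
    by_contra hdD
    refine h1 fun e he => ?_
    rw [t.color_injective he]
    exact hdD
  · exact fun hd => ⟨h hd, fun h1 => h1 ⟨d, h hd⟩ rfl hd⟩

end ColoredTriangulation

open ColoredTriangulation

/-- A diagonal of `D'` outside `D` could be flipped away in `t` without leaving the face of `D`.
Thus a face determines its diagonals. -/
theorem Triangulation.setOf_subset_iff {D D' : Finset (Diagonal n)} {t : Triangulation n}
    (ht : D ⊆ t.1) :
    {s : Triangulation n | D ⊆ s.1} ⊆ {s | D' ⊆ s.1} ↔ D' ⊆ D := by
  constructor
  · intro h d hd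
    by_contra hdD
    have hD' : D' ⊆ t.1 := h ht
    obtain ⟨u, d', hf⟩ := t.exists_isFlip (hD' hd)
    exact hf.not_mem (h (FlipStep.subset ⟨d, d', hdD, hf⟩ ht : D ⊆ u.1) hd)
  · exact fun h s hs => h.trans hs

/-! ### Vertex sets of colorful faces and their images -/

section FaceSet

variable {C C' : Finset (Fin n)} {t s : ColoredTriangulation n}

theorem iSup_exchangeGraph_adj :
    (⨆ c ∈ C, exchangeGraph n c).Adj t s ↔ ∃ c ∈ C, IsColoredFlip c t s := by
  simp only [SimpleGraph.iSup_adj, exists_prop]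
  rfl

theorem mem_faceSet_self (C : Finset (Fin n)) (t : ColoredTriangulation n) :
    t ∈ faceSet (exchangeGraph n) C t := SimpleGraph.Reachable.refl t

theorem faceSet_eq_of_mem (h : s ∈ faceSet (exchangeGraph n) C t) :
    faceSet (exchangeGraph n) C t = faceSet (exchangeGraph n) C s :=
  Set.ext fun _ => ⟨fun hr => (SimpleGraph.Reachable.symm h).trans hr,
    fun hr => SimpleGraph.Reachable.trans h hr⟩

theorem faceSet_mono (h : C ⊆ C') :
    faceSet (exchangeGraph n) C t ⊆ faceSet (exchangeGraph n) C' t := fun _ hs =>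
  SimpleGraph.Reachable.mono (biSup_mono fun _ hc => h hc) hs

theorem color_eq_of_mem_faceSet (h : s ∈ faceSet (exchangeGraph n) C t) (d : Diagonal n)
    (hd : d ∈ t.supp.1) (hc : t.color ⟨d, hd⟩ ∉ C) :
    ∃ hd' : d ∈ s.supp.1, s.color ⟨d, hd'⟩ = t.color ⟨d, hd⟩ := by
  obtain ⟨p⟩ := h
  induction p with
  | nil => exact ⟨hd, rfl⟩
  | @cons t r s hadj p ih =>
    obtain ⟨c, hcC, x, x', hx, hx', hf, h1, h2, h3⟩ := iSup_exchangeGraph_adj.1 hadj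
    have hdx : d ≠ x := by
      rintro rfl
      exact hc (h1 ▸ hcC)
    have hdr : d ∈ r.supp.1 := by
      rw [hf.2.2]
      exact Finset.mem_insert_of_mem (Finset.mem_erase.2 ⟨hdx, hd⟩)
    have e := h3 d hd hdr
    obtain ⟨hd', h4⟩ := ih hdr (e ▸ hc)
    exact ⟨hd', h4.trans e.symm⟩

theorem exists_mem_faceSet_of_reflTransGen {D : Finset (Diagonal n)} {u v : Triangulation n}
    (h : Relation.ReflTransGen (Triangulation.FlipStep D) u v) (t : ColoredTriangulation n)
    (hu : t.supp = u) (hD : fixedDiagonals C t ⊆ D) :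
    ∃ s ∈ faceSet (exchangeGraph n) C t, s.supp = v := by
  induction h using Relation.ReflTransGen.head_induction_on generalizing t with
  | refl => exact ⟨t, mem_faceSet_self C t, hu⟩
  | head hs _ ih =>
    subst hu
    obtain ⟨d, d', hd, hf⟩ := hs
    obtain ⟨r, hr, hflip⟩ := t.exists_isColoredFlip hf
    have hdC : t.color ⟨d, hf.1⟩ ∈ C := by
      by_contra hc
      exact hd (hD (mem_fixedDiagonals.2 ⟨hf.1, hc⟩))
    -- The diagonal created by the flip has a color in `C`, so no new fixed diagonal arises.
    have hrD : fixedDiagonals C r ⊆ D := by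
      intro e he
      obtain ⟨her, hec⟩ := mem_fixedDiagonals.1 he
      obtain ⟨x, x', hx, hx', hf', h1, h2, h3⟩ := hflip
      have hex : e ≠ x' := by
        rintro rfl
        exact hec (h2 ▸ hdC)
      have het : e ∈ t.supp.1 := by
        have := her
        rw [hf'.2.2] at this
        exact Finset.mem_of_mem_erase ((Finset.mem_insert.1 this).resolve_left hex)
      exact hD (mem_fixedDiagonals.2 ⟨het, (h3 e het her).symm ▸ hec⟩)
    obtain ⟨s, hs, hsv⟩ := ih r hr hrD
    refine ⟨s, SimpleGraph.Reachable.trans (SimpleGraph.Adj.reachable ?_) hs, hsv⟩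
    exact iSup_exchangeGraph_adj.2 ⟨_, hdC, hflip⟩

theorem image_supp_faceSet (C : Finset (Fin n)) (t : ColoredTriangulation n) :
    supp '' faceSet (exchangeGraph n) C t = {s | fixedDiagonals C t ⊆ s.1} := by
  ext u
  constructor
  · rintro ⟨s, hs, rfl⟩ d hd
    obtain ⟨h1, h2⟩ := mem_fixedDiagonals.1 hd
    exact (color_eq_of_mem_faceSet hs d h1 h2).1
  · intro hu
    obtain ⟨s, hs, hsu⟩ := exists_mem_faceSet_of_reflTransGen (C := C)
      (Triangulation.reflTransGen_flipStep (fixedDiagonals_subset C t) hu) t rfl subset_rfl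
    exact ⟨s, hs, hsu⟩

theorem image_supp_faceSet_subset_iff :
    supp '' faceSet (exchangeGraph n) C t ⊆ supp '' faceSet (exchangeGraph n) C' t ↔ C ⊆ C' := by
  rw [image_supp_faceSet, image_supp_faceSet,
    Triangulation.setOf_subset_iff (fixedDiagonals_subset C t), fixedDiagonals_subset_iff]

theorem faceSet_empty (t : ColoredTriangulation n) :
    faceSet (exchangeGraph n) ∅ t = {t} := by
  ext s
  refine ⟨fun h => ?_, fun h => h ▸ mem_faceSet_self _ _⟩
  obtain ⟨p⟩ := h
  cases p with
  | nil => rfl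
  | cons h _ =>
    obtain ⟨c, hc, -⟩ := iSup_exchangeGraph_adj.1 h
    simp at hc

/-- The two ends of an edge have distinct underlying triangulations. -/
theorem eq_of_mem_faceSet_singleton {c : Fin n} (h : s ∈ faceSet (exchangeGraph n) {c} t)
    (hs : t.supp = s.supp) : t = s := by
  refine ext_color hs fun d hd hd' => ?_
  by_cases hc : t.color ⟨d, hd⟩ = c
  · obtain ⟨⟨e, he⟩, hes⟩ := s.color_bijective.2 c
    have het : e ∈ t.supp.1 := hs ▸ he
    by_cases hec : t.color ⟨e, het⟩ = c
    · obtain rfl : e = d := congrArg Subtype.val (t.color_injective (hec.trans hc.symm))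
      exact hc.trans hes.symm
    · obtain ⟨_, h2⟩ := color_eq_of_mem_faceSet h e het (by simpa using hec)
      exact absurd (h2.symm.trans hes) hec
  · exact (color_eq_of_mem_faceSet h d hd (by simpa using hc)).2.symm

end FaceSet

/-! ### The map on faces and its lifting properties -/

theorem mem_flag_of_comparable {P : Type*} [PartialOrder P] (Φ : Flag P) {x : P}
    (h : ∀ y ∈ Φ, x ≤ y ∨ y ≤ x) : x ∈ Φ := by
  have hc : IsChain (· ≤ ·) (insert x (Φ : Set P)) := Φ.chain_le.insert fun y hy _ => h y hy
  have := Φ.maxChain.2 hc (Set.subset_insert _ _)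
  have hx : x ∈ (Φ : Set P) := this ▸ Set.mem_insert _ _
  exact hx

instance : Finite (ColorfulAssociahedron n) := Subtype.finite

/-- The face `(C, t)`. -/
def colorfulFace (C : Finset (Fin n)) (t : ColoredTriangulation n) : ColorfulAssociahedron n :=
  ⟨faceSet (exchangeGraph n) C t, Or.inr ⟨C, t, rfl⟩⟩

theorem mem_colorfulFace (C : Finset (Fin n)) (t : ColoredTriangulation n) :
    t ∈ (colorfulFace C t).1 := mem_faceSet_self C t

theorem exists_eq_colorfulFace {F : ColorfulAssociahedron n} {t : ColoredTriangulation n}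
    (h : t ∈ F.1) : ∃ C, F = colorfulFace C t := by
  rcases F.2 with h0 | ⟨C, s, hs⟩
  · rw [h0] at h
    exact h.elim
  · exact ⟨C, Subtype.ext (hs.trans (faceSet_eq_of_mem (hs ▸ h)))⟩

/-- The face of the associahedron whose vertices underlie the vertices of `F`. -/
def suppFace (F : ColorfulAssociahedron n) : Associahedron n :=
  ⟨supp '' F.1, by
    rcases F.2 with h | ⟨C, t, h⟩
    · left
      rw [h, Set.image_empty]
    · right
      exact ⟨t.supp, fixedDiagonals C t, fixedDiagonals_subset C t, by rw [h, image_supp_faceSet]⟩⟩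

theorem suppFace_mono : Monotone (suppFace (n := n)) := fun _ _ h => Set.image_mono h

theorem suppFace_recolorFace (σ : Equiv.Perm (Fin n)) (F : ColorfulAssociahedron n) :
    suppFace (recolorFace σ F) = suppFace F :=
  Subtype.ext (Set.image_image supp (recolor σ) F.1)

theorem suppFace_colorfulFace_val (C : Finset (Fin n)) (t : ColoredTriangulation n) :
    (suppFace (colorfulFace C t)).1 = {s | fixedDiagonals C t ⊆ s.1} := image_supp_faceSet C t

/-- Any vertex of a face can serve as its base point, so both faces are based at `t` and either
inclusion amounts to inclusion of color sets. -/
theorem suppFace_le_iff_of_mem {F G : ColorfulAssociahedron n} {t : ColoredTriangulation n}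
    (hF : t ∈ F.1) (hG : t ∈ G.1) : suppFace F ≤ suppFace G ↔ F ≤ G := by
  refine ⟨fun h => ?_, fun h => suppFace_mono h⟩
  obtain ⟨C, rfl⟩ := exists_eq_colorfulFace hF
  obtain ⟨C', rfl⟩ := exists_eq_colorfulFace hG
  exact faceSet_mono (image_supp_faceSet_subset_iff.1 h)

theorem eq_of_suppFace_eq_of_mem {F G : ColorfulAssociahedron n} {t : ColoredTriangulation n}
    (hF : t ∈ F.1) (hG : t ∈ G.1) (h : suppFace F = suppFace G) : F = G :=
  le_antisymm ((suppFace_le_iff_of_mem hF hG).1 h.le) ((suppFace_le_iff_of_mem hG hF).1 h.ge)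

theorem suppFace_eq_empty {F : ColorfulAssociahedron n} : (suppFace F).1 = ∅ ↔ F.1 = ∅ :=
  Set.image_eq_empty

theorem eq_of_le_of_suppFace_eq {F G : ColorfulAssociahedron n} (hFG : F ≤ G)
    (h : suppFace F = suppFace G) : F = G := by
  rcases F.1.eq_empty_or_nonempty with h0 | ⟨t, ht⟩
  · have hG : G.1 = ∅ := by rw [← suppFace_eq_empty, ← h, suppFace_eq_empty, h0]
    exact Subtype.ext (h0.trans hG.symm)
  · exact eq_of_suppFace_eq_of_mem ht (hFG ht) h

/-- Recolor `G` so that it shares a vertex with `F`; the order is then reflected. -/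
theorem exists_le_recolorFace {F G : ColorfulAssociahedron n} (h : suppFace F ≤ suppFace G) :
    ∃ σ, F ≤ recolorFace σ G := by
  rcases F.1.eq_empty_or_nonempty with h0 | ⟨t, ht⟩
  · exact ⟨1, fun x hx => (h0 ▸ hx : x ∈ (∅ : Set _)).elim⟩
  · obtain ⟨s, hs, hst⟩ := h ⟨t, ht, rfl⟩
    obtain ⟨σ, hσ⟩ := exists_recolor_eq hst
    refine ⟨σ, (suppFace_le_iff_of_mem (G := recolorFace σ G) ht ⟨s, hs, hσ⟩).1 ?_⟩
    rwa [suppFace_recolorFace]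

theorem suppFace_eq_iff {F G : ColorfulAssociahedron n} :
    suppFace F = suppFace G ↔ ∃ σ, recolorFace σ G = F := by
  constructor
  · intro h
    obtain ⟨σ, hσ⟩ := exists_le_recolorFace h.le
    exact ⟨σ, (eq_of_le_of_suppFace_eq hσ (h.trans (suppFace_recolorFace σ G).symm)).symm⟩
  · rintro ⟨σ, rfl⟩
    exact suppFace_recolorFace σ G

/-- Every face above the image of `F` is the image of a face above `F`; it lies below any face
whose image is large enough and which has a prescribed vertex in common with it. -/
theorem exists_suppFace_eq_of_mem {F : ColorfulAssociahedron n} {y : Associahedron n}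
    {t : ColoredTriangulation n} (hF : F.1 = ∅ ∨ t ∈ F.1) (ht : t.supp ∈ y.1)
    (hy : suppFace F ≤ y) :
    ∃ G, suppFace G = y ∧ F ≤ G ∧
      ∀ H : ColorfulAssociahedron n, t ∈ H.1 → y ≤ suppFace H → G ≤ H := by
  rcases y.2 with h0 | ⟨u, D, -, hD⟩
  · rw [h0] at ht
    exact ht.elim
  have hDt : D ⊆ t.supp.1 := by
    rw [hD] at ht
    exact ht
  obtain ⟨C, hC⟩ := exists_fixedDiagonals_eq hDt
  have hG : suppFace (colorfulFace C t) = y := by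
    refine Subtype.ext ?_
    rw [suppFace_colorfulFace_val, hC, hD]
  refine ⟨colorfulFace C t, hG, ?_, fun H hH hyH =>
    (suppFace_le_iff_of_mem (mem_colorfulFace C t) hH).1 (hG.le.trans hyH)⟩
  rcases hF with h0 | hF
  · exact fun x hx => (h0 ▸ hx : x ∈ (∅ : Set _)).elim
  · exact (suppFace_le_iff_of_mem hF (mem_colorfulFace C t)).1 (hy.trans hG.ge)

theorem exists_suppFace_eq {F : ColorfulAssociahedron n} {y : Associahedron n}
    (hy : suppFace F ≤ y) : ∃ G, suppFace G = y ∧ F ≤ G := by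
  rcases F.1.eq_empty_or_nonempty with h0 | ⟨t, ht⟩
  · rcases y.1.eq_empty_or_nonempty with hy0 | ⟨u, hu⟩
    · exact ⟨F, Subtype.ext ((suppFace_eq_empty.2 h0).trans hy0.symm), le_rfl⟩
    · obtain ⟨t, rfl⟩ := exists_supp_eq u
      obtain ⟨G, h1, h2, -⟩ := exists_suppFace_eq_of_mem (Or.inl h0) hu hy
      exact ⟨G, h1, h2⟩
  · obtain ⟨G, h1, h2, -⟩ := exists_suppFace_eq_of_mem (Or.inr ht) (hy ⟨t, ht, rfl⟩) hy
    exact ⟨G, h1, h2⟩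

theorem exists_suppFace_eq_of_le {F H : ColorfulAssociahedron n} {y : Associahedron n}
    (hFH : F ≤ H) (hy : suppFace F ≤ y) (hyH : y ≤ suppFace H) :
    ∃ G, suppFace G = y ∧ F ≤ G ∧ G ≤ H := by
  rcases F.1.eq_empty_or_nonempty with h0 | ⟨t, ht⟩
  · rcases y.1.eq_empty_or_nonempty with hy0 | ⟨u, hu⟩
    · exact ⟨F, Subtype.ext ((suppFace_eq_empty.2 h0).trans hy0.symm), le_rfl, hFH⟩
    · obtain ⟨t, ht, rfl⟩ := hyH hu
      obtain ⟨G, h1, h2, h3⟩ := exists_suppFace_eq_of_mem (Or.inl h0) hu hy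
      exact ⟨G, h1, h2, h3 H ht hyH⟩
  · obtain ⟨G, h1, h2, h3⟩ := exists_suppFace_eq_of_mem (Or.inr ht) (hy ⟨t, ht, rfl⟩) hy
    exact ⟨G, h1, h2, h3 H (hFH ht) hyH⟩

/-- The empty face. -/
def emptyFace (n : ℕ) : ColorfulAssociahedron n := ⟨∅, Or.inl rfl⟩

theorem emptyFace_le (F : ColorfulAssociahedron n) : emptyFace n ≤ F := Set.empty_subset F.1

/-! ### Images of flags and adjacency -/

theorem emptyFace_mem (Φ : Flag (ColorfulAssociahedron n)) : emptyFace n ∈ Φ :=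
  mem_flag_of_comparable Φ fun F _ => Or.inl (emptyFace_le F)

theorem suppFace_surjective : Function.Surjective (suppFace (n := n)) := fun y => by
  obtain ⟨G, hG, -⟩ := exists_suppFace_eq (F := emptyFace n) (y := y)
    (fun x hx => by simp [suppFace, emptyFace] at hx)
  exact ⟨G, hG⟩

/-- A face `y` comparable to the whole image lifts to a face between the largest face of `Φ` mapped
below `y` and the smallest one mapped above it, if any. The lift is comparable to all of `Φ`, hence
belongs to it. -/
theorem isMaxChain_image_suppFace (Φ : Flag (ColorfulAssociahedron n)) :
    IsMaxChain (· ≤ ·) (suppFace '' (Φ : Set (ColorfulAssociahedron n))) := by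
  refine ⟨?_, fun s hs hsub => hsub.antisymm fun y hy => ?_⟩
  · rintro _ ⟨F, hF, rfl⟩ _ ⟨G, hG, rfl⟩ -
    exact (Φ.le_or_le hF hG).imp (fun h => suppFace_mono h) fun h => suppFace_mono h
  have hcmp : ∀ F ∈ Φ, suppFace F ≤ y ∨ y ≤ suppFace F := fun F hF =>
    hs.total (hsub ⟨F, hF, rfl⟩) hy
  suffices ∃ G ∈ Φ, suppFace G = y from this
  obtain ⟨F, ⟨hF, hFy⟩, hFmax⟩ := Set.Finite.exists_maximal
    (Set.toFinite {F | F ∈ Φ ∧ suppFace F ≤ y})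
    ⟨emptyFace n, emptyFace_mem Φ, fun x hx => by simp [suppFace, emptyFace] at hx⟩
  have hbelow : ∀ K ∈ Φ, suppFace K ≤ y → K ≤ F := fun K hK hKy =>
    (Φ.le_or_le hK hF).elim id fun h => hFmax ⟨hK, hKy⟩ h
  by_cases hne : ∃ H ∈ Φ, y ≤ suppFace H
  · obtain ⟨H, ⟨hH, hHy⟩, hHmin⟩ := Set.Finite.exists_minimal
      (Set.toFinite {H | H ∈ Φ ∧ y ≤ suppFace H}) hne
    have habove : ∀ K ∈ Φ, y ≤ suppFace K → H ≤ K := fun K hK hKy =>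
      (Φ.le_or_le hH hK).elim id fun h => hHmin ⟨hK, hKy⟩ h
    rcases Φ.le_or_le hF hH with hFH | hHF
    · obtain ⟨G, hG, hFG, hGH⟩ := exists_suppFace_eq_of_le hFH hFy hHy
      refine ⟨G, mem_flag_of_comparable Φ fun K hK => ?_, hG⟩
      rcases hcmp K hK with h | h
      · exact Or.inr ((hbelow K hK h).trans hFG)
      · exact Or.inl (hGH.trans (habove K hK h))
    · exact ⟨F, hF, le_antisymm hFy (hHy.trans (suppFace_mono hHF))⟩
  · obtain ⟨G, hG, hFG⟩ := exists_suppFace_eq hFy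
    refine ⟨G, mem_flag_of_comparable Φ fun K hK => Or.inr ?_, hG⟩
    exact (hbelow K hK ((hcmp K hK).resolve_right fun h => hne ⟨K, hK, h⟩)).trans hFG

theorem colorfulFace_empty_le {F : ColorfulAssociahedron n} {t : ColoredTriangulation n}
    (h : t ∈ F.1) : colorfulFace ∅ t ≤ F := by
  intro s hs
  rw [show s = t by simpa [colorfulFace, faceSet_empty] using hs]
  exact h

/-- If two flags differ only in the vertices `t` and `s`, whose underlying triangulations agree,
then `t = s`. -/
theorem eq_of_vertices_of_sdiff_eq {Φ Ψ : Flag (ColorfulAssociahedron n)}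
    {t s : ColoredTriangulation n} (ht : colorfulFace ∅ t ∈ Φ) (hs : colorfulFace ∅ s ∈ Ψ)
    (hΦ : ∀ H ∈ Φ, H = colorfulFace ∅ t ∨ H ∈ Ψ) (hsupp : t.supp = s.supp) :
    t = s := by
  by_contra hts
  obtain ⟨c₀⟩ : Nonempty (Fin n) := by
    by_contra hn
    rw [not_nonempty_iff] at hn
    exact hts (ext_color hsupp fun d hd _ => (hn.false (t.color ⟨d, hd⟩)).elim)
  -- The smallest face of `Φ` strictly above the vertex is some `(C, t)` with `C` nonempty. Any edge
  -- `({c}, t)` with `c ∈ C` fits in between, so it is in `Φ`.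
  have key : ∃ c, colorfulFace {c} t ∈ Φ := by
    have hcase : ∀ c, (∀ K ∈ Φ, colorfulFace ∅ t < K → colorfulFace {c} t ≤ K) →
        colorfulFace {c} t ∈ Φ := fun c hc => mem_flag_of_comparable Φ fun K hK => by
      have hle : colorfulFace ∅ t ≤ colorfulFace {c} t := faceSet_mono (Finset.empty_subset _)
      rcases Φ.le_or_le hK ht with h | h
      · exact Or.inr (h.trans hle)
      · rcases h.eq_or_lt with rfl | h
        · exact Or.inr hle
        · exact Or.inl (hc K hK h)
    by_cases hne : ∃ K ∈ Φ, colorfulFace ∅ t < K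
    · obtain ⟨K, ⟨hK, hlt⟩, hmin⟩ := Set.Finite.exists_minimal
        (Set.toFinite {K | K ∈ Φ ∧ colorfulFace ∅ t < K}) hne
      obtain ⟨C, rfl⟩ := exists_eq_colorfulFace (hlt.le (mem_colorfulFace ∅ t))
      obtain ⟨c, hc⟩ : C.Nonempty := by
        rw [Finset.nonempty_iff_ne_empty]
        rintro rfl
        exact hlt.ne rfl
      refine ⟨c, hcase c fun H hH hHlt => ?_⟩
      have hCH : colorfulFace C t ≤ H :=
        (Φ.le_or_le hK hH).elim id fun h => hmin ⟨hH, hHlt⟩ h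
      exact le_trans (faceSet_mono (Finset.singleton_subset_iff.2 hc)) hCH
    · exact ⟨c₀, hcase c₀ fun K hK h => (hne ⟨K, hK, h⟩).elim⟩
  obtain ⟨c, hc⟩ := key
  -- The edge is not a vertex, so it also lies in `Ψ` and is comparable to the vertex `s`.
  rcases hΦ _ hc with h | hcΨ
  · have : ({c} : Finset (Fin n)) ⊆ ∅ := image_supp_faceSet_subset_iff.1
      (Set.image_mono (f := supp) (congrArg Subtype.val h).subset)
    simp at this
  · rcases Ψ.le_or_le hcΨ hs with h | h
    · have h1 := h (mem_colorfulFace {c} t)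
      exact hts (by simpa [colorfulFace, faceSet_empty] using h1)
    · exact hts (eq_of_mem_faceSet_singleton (h (mem_colorfulFace ∅ s)) hsupp)

theorem suppFace_ne_of_sdiff_eq {Φ Ψ : Flag (ColorfulAssociahedron n)}
    {F G : ColorfulAssociahedron n} (hF : F ∈ Φ) (hFΨ : F ∉ Ψ) (hG : G ∈ Ψ)
    (hΦ : ∀ H ∈ Φ, H = F ∨ H ∈ Ψ) : suppFace F ≠ suppFace G := by
  intro h
  have hFG : F ≠ G := fun e => hFΨ (e ▸ hG)
  obtain ⟨t, ht⟩ : F.1.Nonempty := by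
    rw [Set.nonempty_iff_ne_empty]
    intro h0
    obtain rfl : F = emptyFace n := Subtype.ext h0
    exact hFΨ (emptyFace_mem Ψ)
  -- A nonempty face of `Φ` strictly below `F` also lies in `Ψ` and ties `F` to `G`. Otherwise `F`
  -- is a vertex, and so is `G`, having the same image.
  by_cases hH : ∃ H ∈ Φ, H ≠ F ∧ H.1.Nonempty ∧ H ≤ F
  · obtain ⟨H, hHΦ, hHF, ⟨s, hs⟩, hle⟩ := hH
    rcases Ψ.le_or_le ((hΦ H hHΦ).resolve_left hHF) hG with h1 | h1
    · exact hFG (eq_of_suppFace_eq_of_mem (hle hs) (h1 hs) h)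
    · exact hFG (eq_of_le_of_suppFace_eq (h1.trans hle) h.symm).symm
  · have hcF : colorfulFace ∅ t ≤ F := colorfulFace_empty_le ht
    have hmem : colorfulFace ∅ t ∈ Φ := mem_flag_of_comparable Φ fun K hK => by
      rcases Φ.le_or_le hF hK with h1 | h1
      · exact Or.inl (hcF.trans h1)
      · by_cases hKF : K = F
        · exact Or.inl (hKF ▸ hcF)
        · refine Or.inr fun x hx => (hH ⟨K, hK, hKF, ⟨x, hx⟩, h1⟩).elim
    obtain rfl : colorfulFace ∅ t = F := by
      by_contra hne
      exact hH ⟨_, hmem, hne, ⟨t, mem_colorfulFace ∅ t⟩, hcF⟩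
    obtain ⟨s, hs, hst⟩ : t.supp ∈ (suppFace G).1 := h ▸ ⟨t, ht, rfl⟩
    have hsG : colorfulFace ∅ s = G := by
      refine eq_of_le_of_suppFace_eq (colorfulFace_empty_le hs) (Eq.trans ?_ h)
      obtain ⟨σ, rfl⟩ := exists_recolor_eq hst
      exact Subtype.ext (by simp [suppFace, colorfulFace, faceSet_empty, hst])
    rw [← hsG] at hG
    exact hFG (hsG ▸ congrArg _ (eq_of_vertices_of_sdiff_eq hF hG hΦ hst.symm))

theorem image_suppFace_sdiff {Φ Ψ : Flag (ColorfulAssociahedron n)}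
    {F G : ColorfulAssociahedron n} (hΦ : (Φ : Set (ColorfulAssociahedron n)) \ Ψ = {F})
    (hΨ : (Ψ : Set (ColorfulAssociahedron n)) \ Φ = {G}) :
    (suppFace '' (Φ : Set (ColorfulAssociahedron n))) \ suppFace '' (Ψ : Set _) =
      {suppFace F} := by
  obtain ⟨hF, hFΨ⟩ : F ∈ (Φ : Set _) \ (Ψ : Set _) := hΦ ▸ rfl
  obtain ⟨hG, hGΦ⟩ : G ∈ (Ψ : Set _) \ (Φ : Set _) := hΨ ▸ rfl
  have hΦ' : ∀ H ∈ Φ, H = F ∨ H ∈ Ψ := fun H hH =>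
    or_iff_not_imp_right.2 fun hHΨ => (hΦ ▸ ⟨hH, hHΨ⟩ : H ∈ ({F} : Set _))
  have hΨ' : ∀ H ∈ Ψ, H = G ∨ H ∈ Φ := fun H hH =>
    or_iff_not_imp_right.2 fun hHΦ => (hΨ ▸ ⟨hH, hHΦ⟩ : H ∈ ({G} : Set _))
  refine Set.Subset.antisymm ?_ (Set.singleton_subset_iff.2 ⟨⟨F, hF, rfl⟩, ?_⟩)
  · rintro _ ⟨⟨H, hH, rfl⟩, hHΨ⟩
    rcases hΦ' H hH with rfl | h
    · rfl
    · exact (hHΨ ⟨H, h, rfl⟩).elim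
  · rintro ⟨H, hH, hHF⟩
    rcases hΨ' H hH with rfl | hHΦ
    · exact suppFace_ne_of_sdiff_eq hF hFΨ hG hΦ' hHF.symm
    · refine hFΨ ?_
      rcases Φ.le_or_le hF hHΦ with h | h
      · rwa [eq_of_le_of_suppFace_eq h hHF.symm]
      · rwa [← eq_of_le_of_suppFace_eq h hHF]

/-! ### Ranks, the covering and the quotient -/

theorem hasRank_suppFace (F : ColorfulAssociahedron n) (j : ℤ) :
    ColorfulPolytope.HasRank F j ↔ Associahedron.HasRank (suppFace F) j := by
  constructor
  · rintro (⟨h, hj⟩ | ⟨C, t, h, hj⟩)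
    · exact Or.inl ⟨suppFace_eq_empty.2 h, hj⟩
    · obtain rfl : F = colorfulFace C t := Subtype.ext h
      refine Or.inr ⟨t.supp, fixedDiagonals C t, fixedDiagonals_subset C t,
        suppFace_colorfulFace_val C t, ?_⟩
      rw [card_fixedDiagonals]
      omega
  · rintro (⟨h, hj⟩ | ⟨u, D, hD, h, hj⟩)
    · exact Or.inl ⟨suppFace_eq_empty.1 h, hj⟩
    · obtain ⟨t, ht, rfl⟩ : u ∈ (suppFace F).1 := by
        rw [h]
        exact hD
      obtain ⟨C, rfl⟩ := exists_eq_colorfulFace ht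
      refine Or.inr ⟨C, t, rfl, ?_⟩
      rw [suppFace_colorfulFace_val] at h
      -- The two descriptions of the image give the same diagonals, so `D` has `n - |C|` elements.
      have h1 := (Triangulation.setOf_subset_iff (fixedDiagonals_subset C t)).1 h.subset
      have h2 := (Triangulation.setOf_subset_iff hD).1 h.superset
      have := card_fixedDiagonals C t
      rw [h2.antisymm h1] at this
      omega

theorem isCovering_suppFace :
    IsCovering ColorfulPolytope.HasRank Associahedron.HasRank (suppFace (n := n)) where
  monotone := suppFace_mono
  surjective := suppFace_surjective
  rank_preserving := hasRank_suppFace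
  adjacency_preserving := by
    rintro Φ Ψ ⟨h1, h2⟩
    obtain ⟨F, hF⟩ := Set.ncard_eq_one.1 h1
    obtain ⟨G, hG⟩ := Set.ncard_eq_one.1 h2
    refine ⟨Flag.ofIsMaxChain _ (isMaxChain_image_suppFace Φ),
      Flag.ofIsMaxChain _ (isMaxChain_image_suppFace Ψ), rfl, rfl, ?_, ?_⟩
    · exact Set.ncard_eq_one.2 ⟨_, image_suppFace_sdiff hF hG⟩
    · exact Set.ncard_eq_one.2 ⟨_, image_suppFace_sdiff hG hF⟩

theorem mk_eq_mk_iff {F G : ColorfulAssociahedron n} :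
    PolytopeQuotient.mk (colorSubgroup n) F = PolytopeQuotient.mk (colorSubgroup n) G ↔
      suppFace F = suppFace G := by
  rw [suppFace_eq_iff]
  refine Quotient.eq.trans (MulAction.orbitRel_apply.trans ?_)
  constructor
  · rintro ⟨⟨_, σ, rfl⟩, h⟩
    exact ⟨σ, h⟩
  · rintro ⟨σ, h⟩
    exact ⟨⟨_, σ, rfl⟩, h⟩

/-- The map on the quotient induced by `suppFace`. -/
def quotientSuppFace (n : ℕ) (x : PolytopeQuotient (colorSubgroup n)) : Associahedron n :=
  Quotient.lift suppFace (fun _ _ h => mk_eq_mk_iff.1 (Quotient.sound h)) x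

theorem quotientSuppFace_bijective : Function.Bijective (quotientSuppFace n) := by
  refine ⟨fun x y => ?_, fun y => ?_⟩
  · induction x using Quotient.inductionOn
    induction y using Quotient.inductionOn
    exact fun h => mk_eq_mk_iff.2 h
  · obtain ⟨F, rfl⟩ := suppFace_surjective y
    exact ⟨PolytopeQuotient.mk _ F, rfl⟩

theorem quotientSuppFace_le_iff {x y : PolytopeQuotient (colorSubgroup n)} :
    quotientSuppFace n x ≤ quotientSuppFace n y ↔ x ≤ y := by
  constructor
  · induction x using Quotient.inductionOn with | _ F
    induction y using Quotient.inductionOn with | _ G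
    intro h
    obtain ⟨σ, hσ⟩ := exists_le_recolorFace h
    exact ⟨F, recolorFace σ G, rfl, mk_eq_mk_iff.2 (suppFace_recolorFace σ G), hσ⟩
  · rintro ⟨F, G, rfl, rfl, h⟩
    exact suppFace_mono h

/-- The quotient of the colorful associahedron by the color permutations is the associahedron. -/
noncomputable def quotientOrderIso (n : ℕ) :
    PolytopeQuotient (colorSubgroup n) ≃o Associahedron n where
  toEquiv := Equiv.ofBijective _ quotientSuppFace_bijective
  map_rel_iff' := quotientSuppFace_le_iff

end Assoc

theorem theorem4p1 (n : ℕ) :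
    ∃ Φ : Assoc.PolytopeQuotient (Assoc.colorSubgroup n) ≃o Assoc.Associahedron n,
      Assoc.IsCovering Assoc.ColorfulPolytope.HasRank Assoc.Associahedron.HasRank
        (fun F : Assoc.ColorfulAssociahedron n =>
          Φ (Assoc.PolytopeQuotient.mk (Assoc.colorSubgroup n) F)) :=
  ⟨Assoc.quotientOrderIso n, Assoc.isCovering_suppFace⟩
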